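/- **Feynman integrals.** Let $L\ge 1$ and $E,p\ge 0$ be integers. Consider the $L$-loop Feynman integral in $D=D_0-2\epsilon$ dimensions ($D_0\in\mathbb N$) $$I=\int\Big(\prod_{j=1}^{L}e^{\gamma_E\epsilon}\frac{\mathrm d^Dk_j}{i\pi^{D/2}}\Big)\frac{\mathcal N(\{k_j\cdot k_l,\,k_j\cdot p_l\};D)}{\prod_{e=1}^{p}(m_e^2-q_e^2-i0)^{\nu_e}},\qquad q_e=\sum_{l=1}^{L}a_{el}k_l+\sum_{j=1}^{E}b_{ej}p_j,$$ with $\nu\in\mathbb Z^p$, $m_e^2\ge 0$, $a_{el},b_{ej}\in\{-1,0,1\}$, $\operatorname{rank}(a)=L$, external momenta with real symmetric scalar products $p_i\cdot p_j$ and $\sum_jp_j=0$, and a polynomial $\mathcal N$ in the indicated scalar products, with complex coefficients that may depend on $D$. Its external scales are $x=(\{p_i\cdot p_j\}_{i,j},\{m_e^2\}_e)$; it is *scaleless* if $x=0$. **Schwinger integrand.** For $\alpha\in(0,\infty)^p$ put $M=a^{T}\mathrm{diag}(\alpha)a$, $H=a^{T}\mathrm{diag}(\alpha)b$, $\mathcal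 U=\det M$ and $$\mathcal F=\mathcal U\Big(\sum_e\alpha_em_e^2-\sum_{e,i,j}\alpha_eb_{ei}b_{ej}\,p_i\cdot p_j\Big)+\mathrm{tr}\big(\mathrm{adj}(M)\,H\,(p_i\cdot p_j)_{ij}H^{T}\big).$$ Let $\langle\mathcal N\rangle_{D,\alpha}$ be the $D$-dimensional Gaussian average of $\mathcal N$ with mean $k=-M^{-1}Hp$ and covariance $\langle\kappa_i^\mu\kappa_j^\nu\rangle=\tfrac i2(M^{-1})_{ij}g^{\mu\nu}$, that is, $\exp\big(\tfrac i4\sum_{i,j}(M^{-1})_{ij}\,\partial_{k_i}\cdot\partial_{k_j}\big)\mathcal N$ evaluated at the mean, where $\partial_{k_i}\cdot\partial_{k_j}$ acts on polynomials in scalar products by the chain rule with $g^\mu{}_\mu=D$. For complex exponents $\nu\in\mathbb C^p$ and $D\in\mathbb C$ put $$\Phi_{\nu,D}(\alpha)=e^{\gamma_EL\epsilon}\,i^{\,\sum_e\nu_e-LD/2}\prod_{e}\frac{\alpha_e^{\nu_e-1}}{\Gamma(\nu_e)}\;\mathcal U^{-D/2}\,\langle\mathcal N\rangle_{D,\alpha}\,e^{-i\mathcal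 F/\mathcal U},\qquad \epsilon=\tfrac{D_0-D}{2}.$$ **Dimensional regularisation.** For each $j$ let the sector $\Delta_j$ be the set of $\alpha\in(0,\infty)^p$ with $\alpha_i\le\alpha_j$ for all $i$. For fixed $D$ and fixed $\nu_i$ ($i\ne j$) with large real parts, the integral of $\Phi_{\nu,D}$ over $\Delta_j\cap\{\alpha_j<1\}$ is taken as a function of $\nu_j$, absolutely convergent for $\mathrm{Re}\,\nu_j$ large, and continued meromorphically to $\nu_j\in\mathbb C$; the integral over $\Delta_j\cap\{\alpha_j\ge1\}$ is continued in the same way from $\mathrm{Re}\,\nu_j$ very negative. The sum of the two continuations is then continued to a meromorphic function $I_j(\nu,D)=P_j/Q_j$ on $\mathbb C^p\times\mathbb C$ ($P_j,Q_j$ entire, $Q_j\ne 0$). Here the coefficients of $\mathcal N$ are held at their values at the dimension in question. The dimensionally regularised integral *has the value $v$* at $\nu\in\mathbb Z^p$ in dimension $D$ if these continuations exist, $\sum_jI_j$ can be written as a quotient $P/Q$ of entire functions with $Q(\nu,D)\neq 0$, and $v=P(\nu,D)/Q(\nu,D)$. **Proposition.** In dimensional regularisation all scaleless integrals vanish: if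 $x=0$, then for every $\epsilon\in\mathbb C$ the dimensionally regularised value of the integral in dimension $D=D_0-2\epsilon$ exists, is unique, and equals $0$. -/

import Mathlib

/-- The labels of the scalar products that involve at least one loop momentum, for `L` loop momenta
and `E` external momenta: `(a, Sum.inl b)` stands for `k_a · k_b` and `(a, Sum.inr e)` for
`k_a · p_e`. -/
abbrev LoopDot (L E : ℕ) : Type := Fin L × (Fin L ⊕ Fin E)

/-- The data of an `L`-loop Feynman integral with `E` external momenta and `p` propagators,
`∫ (∏_j e^{γε} d^D k_j / (i π^{D/2})) N / ∏_e (m_e² - q_e² - i0)^{ν_e}` with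
`q_e = ∑_l a_{el} k_l + ∑_j b_{ej} p_j` and `D = D₀ - 2ε`. In non-integer dimension the external
momenta enter only through their (Minkowski, mostly minus) scalar products `p_i · p_j`. -/
structure FeynmanIntegral (L E p : ℕ) where
  /-- coefficients of the loop momenta in the propagator momenta -/
  a : Matrix (Fin p) (Fin L) ℤ
  /-- coefficients of the external momenta in the propagator momenta -/
  b : Matrix (Fin p) (Fin E) ℤ
  a_mem : ∀ e l, a e l = -1 ∨ a e l = 0 ∨ a e l = 1
  b_mem : ∀ e j, b e j = -1 ∨ b e j = 0 ∨ b e j = 1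
  /-- the `L` loop momenta are independent -/
  rank_a : (a.map (Int.cast : ℤ → ℝ)).rank = L
  /-- the scalar products `p_i · p_j` of the external momenta -/
  dot : Matrix (Fin E) (Fin E) ℝ
  dot_symm : ∀ i j, dot i j = dot j i
  /-- momentum conservation `∑_j p_j = 0` -/
  conservation : ∀ i, ∑ j, dot i j = 0
  /-- the squared propagator masses -/
  msq : Fin p → ℝ
  msq_nonneg : ∀ e, 0 ≤ msq e
  /-- the exponents of the propagators -/
  ν : Fin p → ℤ
  /-- the integer `D₀` in `D = D₀ - 2ε` -/
  D₀ : ℕ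
  /-- the numerator, a polynomial in the scalar products that involve a loop momentum,
  with coefficients that may depend on the dimension `D` -/
  num : ℂ → MvPolynomial (LoopDot L E) ℂ

namespace FeynmanIntegral

variable {L E p : ℕ}

/-- All external scales `p_i · p_j` and `m_e²` vanish. -/
def Scaleless (F : FeynmanIntegral L E p) : Prop :=
  (∀ i j, F.dot i j = 0) ∧ ∀ e, F.msq e = 0

/-! ### The polynomials of the Schwinger parametrisation

`∑_e α_e q_e² = kᵀ M k + 2 kᵀ H p + pᵀ (bᵀ diag(α) b) p` with `M = aᵀ diag(α) a` and
`H = aᵀ diag(α) b`. -/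

/-- The quadratic form in the loop momenta. -/
noncomputable def M (F : FeynmanIntegral L E p) (α : Fin p → ℝ) : Matrix (Fin L) (Fin L) ℝ :=
  fun l l' => ∑ e, α e * F.a e l * F.a e l'

/-- The mixed form in the loop and external momenta. -/
noncomputable def H (F : FeynmanIntegral L E p) (α : Fin p → ℝ) : Matrix (Fin L) (Fin E) ℝ :=
  fun l j => ∑ e, α e * F.a e l * F.b e j

/-- The first Symanzik polynomial. -/
noncomputable def U (F : FeynmanIntegral L E p) (α : Fin p → ℝ) : ℝ := (F.M α).det

/-- The polynomial `𝓕` of the Schwinger parametrisation,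
`𝓕 / U = ∑_e α_e m_e² - (pᵀ (bᵀ diag(α) b) p - (H p)ᵀ M⁻¹ (H p))`. -/
noncomputable def Fpoly (F : FeynmanIntegral L E p) (α : Fin p → ℝ) : ℝ :=
  F.U α * (∑ e, α e * F.msq e - ∑ e, ∑ i, ∑ j, α e * F.b e i * F.b e j * F.dot i j)
    + ((F.M α).adjugate * (F.H α * F.dot * (F.H α).transpose)).trace

/-! ### Gaussian averages of the numerator in `D` dimensions

With respect to the Gaussian weight `exp (i ∑_e α_e q_e²)` the loop momenta have mean
`-M⁻¹ H p` and covariance `(i/2) (M⁻¹)_{ij} g^{μν}`, so the average of a polynomial in the loop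
momenta is `exp ((i/4) ∑_{ij} (M⁻¹)_{ij} ∂_{k_i} · ∂_{k_j})` applied to it, evaluated at the mean.
On polynomials in scalar products, `∂_{k_i} · ∂_{k_j}` depends polynomially on `D`
(through `g^μ_μ = D`), hence makes sense for every complex `D`. -/

/-- The scalar product of two of the momenta `k_1, …, k_L, p_1, …, p_E`, as a polynomial in the
scalar products that involve a loop momentum. -/
noncomputable def dotPoly (F : FeynmanIntegral L E p) :
    Fin L ⊕ Fin E → Fin L ⊕ Fin E → MvPolynomial (LoopDot L E) ℂ
  | Sum.inl a, s => MvPolynomial.X (a, s)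
  | Sum.inr e, Sum.inl a => MvPolynomial.X (a, Sum.inr e)
  | Sum.inr e, Sum.inr e' => MvPolynomial.C (F.dot e e' : ℂ)

/-- The coefficient of the momentum `r` in the gradient with respect to `k_i` of the scalar
product `v`: the gradient of `k_a · s` is `δ_{ia} s + δ_{s, k_i} k_a`. -/
def gradCoeff (i : Fin L) (v : LoopDot L E) (r : Fin L ⊕ Fin E) : ℂ :=
  (if i = v.1 ∧ r = v.2 then 1 else 0) + (if v.2 = Sum.inl i ∧ r = Sum.inl v.1 then 1 else 0)

/-- The operator `∂_{k_i} · ∂_{k_j}` in `D` dimensions on polynomials in scalar products,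
by the chain rule. -/
noncomputable def laplacian (F : FeynmanIntegral L E p) (D : ℂ) (i j : Fin L)
    (N : MvPolynomial (LoopDot L E) ℂ) : MvPolynomial (LoopDot L E) ℂ :=
  ∑ v, MvPolynomial.C (D * gradCoeff i v (Sum.inl j)) * MvPolynomial.pderiv v N
    + ∑ v, ∑ w, (∑ r, ∑ s, MvPolynomial.C (gradCoeff i v r * gradCoeff j w s) * F.dotPoly r s)
        * MvPolynomial.pderiv v (MvPolynomial.pderiv w N)

/-- The exponent `(i/4) ∑_{ij} (M⁻¹)_{ij} ∂_{k_i} · ∂_{k_j}`. -/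
noncomputable def heat (F : FeynmanIntegral L E p) (D : ℂ) (α : Fin p → ℝ)
    (N : MvPolynomial (LoopDot L E) ℂ) : MvPolynomial (LoopDot L E) ℂ :=
  ∑ i, ∑ j, MvPolynomial.C (Complex.I / 4 * (((F.M α)⁻¹ i j : ℝ) : ℂ)) * F.laplacian D i j N

/-- The scalar products `k_a · k_b` and `k_a · p_e` at the mean `k = -M⁻¹ H p`. -/
noncomputable def meanDot (F : FeynmanIntegral L E p) (α : Fin p → ℝ) : LoopDot L E → ℂ
  | (a, Sum.inl b) => (((F.M α)⁻¹ * F.H α * F.dot * ((F.M α)⁻¹ * F.H α).transpose) a b : ℝ)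
  | (a, Sum.inr e) => ((-((F.M α)⁻¹ * F.H α * F.dot)) a e : ℝ)

/-- The `D`-dimensional Gaussian average of the numerator `N`. Each application of `heat` lowers the
degree, so that the exponential series stops at the degree of `N`. -/
noncomputable def gaussianAverage (F : FeynmanIntegral L E p) (D : ℂ) (α : Fin p → ℝ)
    (N : MvPolynomial (LoopDot L E) ℂ) : ℂ :=
  ∑ n ∈ Finset.range (N.totalDegree + 1),
    ((n.factorial : ℂ))⁻¹ * MvPolynomial.eval (F.meanDot α) ((F.heat D α)^[n] N)

/-- The Schwinger-parameter integrand of the Feynman integral with numerator `N` in `D` dimensions,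
with complex propagator exponents `ν`. It comes from
`(X - i0)^{-ν} = i^ν / Γ(ν) ∫_0^∞ α^{ν-1} e^{-iα(X - i0)} dα` for real `X`, and from
`∫ ∏_j d^D k_j / (i π^{D/2}) e^{-i ∑_e α_e (m_e² - q_e²)} = i^{-LD/2} U^{-D/2} e^{-i 𝓕/U}`. -/
noncomputable def integrand (F : FeynmanIntegral L E p) (N : MvPolynomial (LoopDot L E) ℂ)
    (ν : Fin p → ℂ) (D : ℂ) (α : Fin p → ℝ) : ℂ :=
  Complex.exp ((Real.eulerMascheroniConstant : ℂ) * L * ((F.D₀ - D) / 2))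
    * Complex.I ^ (∑ e, ν e - L * D / 2)
    * (∏ e, (α e : ℂ) ^ (ν e - 1) * (Complex.Gamma (ν e))⁻¹)
    * (F.U α : ℂ) ^ (-D / 2)
    * F.gaussianAverage D α N
    * Complex.exp (-Complex.I * ((F.Fpoly α / F.U α : ℝ) : ℂ))

/-! ### Dimensional regularisation

The integral over the Schwinger parameters is split into the primary sectors "`α_j` is the largest
parameter", and each sector into the part `α_j < 1` (short distances) and the part `1 ≤ α_j`
(large distances). Each part converges absolutely for suitable complex `(ν, D)`, and is continued
analytically from there. -/

/-- The short-distance part of the primary sector `j`. -/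
def sectorUV (j : Fin p) : Set (Fin p → ℝ) :=
  {α | (∀ i, 0 < α i) ∧ (∀ i, α i ≤ α j) ∧ α j < 1}

/-- The large-distance part of the primary sector `j`. -/
def sectorIR (j : Fin p) : Set (Fin p → ℝ) :=
  {α | (∀ i, 0 < α i) ∧ (∀ i, α i ≤ α j) ∧ 1 ≤ α j}

/-- `g` is the integral over the primary sector `j` as a meromorphic function of `ζ = ν_j`, the
other exponents and `D` being fixed: the sum of the meromorphic continuations of the short-distance
part, from large `Re ζ`, and of the large-distance part, from large `-Re ζ`. -/
def IsSectorIntegral (F : FeynmanIntegral L E p) (N : MvPolynomial (LoopDot L E) ℂ) (j : Fin p)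
    (ν : Fin p → ℂ) (D : ℂ) (g : ℂ → ℂ) : Prop :=
  ∃ gUV gIR : ℂ → ℂ, MeromorphicOn gUV Set.univ ∧ MeromorphicOn gIR Set.univ ∧
    (∃ r : ℝ, ∀ ζ : ℂ, r < ζ.re →
      MeasureTheory.IntegrableOn (F.integrand N (Function.update ν j ζ) D) (sectorUV j) ∧
      gUV ζ = ∫ α in sectorUV j, F.integrand N (Function.update ν j ζ) D α) ∧
    (∃ r : ℝ, ∀ ζ : ℂ, ζ.re < r →
      MeasureTheory.IntegrableOn (F.integrand N (Function.update ν j ζ) D) (sectorIR j) ∧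
      gIR ζ = ∫ α in sectorIR j, F.integrand N (Function.update ν j ζ) D α) ∧
    g = gUV + gIR

/-- The meromorphic function `P / Q` (`P`, `Q` entire, `Q ≠ 0`) of all exponents and of the
dimension is the meromorphic continuation of the integral over the primary sector `j`, which is
defined when the real parts of the other exponents are large. -/
def IsSectorContinuation (F : FeynmanIntegral L E p) (N : MvPolynomial (LoopDot L E) ℂ) (j : Fin p)
    (P Q : (Fin p → ℂ) × ℂ → ℂ) : Prop :=
  Differentiable ℂ P ∧ Differentiable ℂ Q ∧ Q ≠ 0 ∧
    ∀ D : ℂ, ∃ R : ℝ, ∀ ν : Fin p → ℂ, (∀ i, i ≠ j → R < (ν i).re) →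
      ∃ g : ℂ → ℂ, F.IsSectorIntegral N j ν D g ∧
        ∀ᶠ ζ in Filter.codiscrete ℂ,
          P (Function.update ν j ζ, D) = Q (Function.update ν j ζ, D) * g ζ

/-- The meromorphic function `P / Q` of the exponents and the dimension is the analytically
regularised Feynman integral with numerator `N`: the sum over the primary sectors of the
continuations `P_j / Q_j`. -/
def IsRegularised (F : FeynmanIntegral L E p) (N : MvPolynomial (LoopDot L E) ℂ)
    (P Q : (Fin p → ℂ) × ℂ → ℂ) : Prop :=
  Differentiable ℂ P ∧ Differentiable ℂ Q ∧ Q ≠ 0 ∧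
    ∃ Ps Qs : Fin p → (Fin p → ℂ) × ℂ → ℂ,
      (∀ j, F.IsSectorContinuation N j (Ps j) (Qs j)) ∧
      ∀ z, P z * ∏ j, Qs j z = Q z * ∑ j, Ps j z * ∏ i ∈ Finset.univ.erase j, Qs i z

/-- The dimensionally regularised Feynman integral is regular in dimension `D` and has the
value `v` there. -/
def HasDimRegValue (F : FeynmanIntegral L E p) (D v : ℂ) : Prop :=
  ∃ P Q : (Fin p → ℂ) × ℂ → ℂ, F.IsRegularised (F.num D) P Q ∧
    Q (fun e => (F.ν e : ℂ), D) ≠ 0 ∧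
    v = P (fun e => (F.ν e : ℂ), D) / Q (fun e => (F.ν e : ℂ), D)

end FeynmanIntegral

/-! Without external scales both `𝓕` and the Gaussian mean vanish, so the Schwinger integrand is a
finite sum over `m` (the order of the Gaussian average) of terms homogeneous in `α`, of degree `∑
(ν_e - 1) - L D / 2 - m`. With `t = α_j` as radial coordinate on a primary sector, each term splits
into a slice integral `J m` over the unit box and a radial integral of `t ^ (z - 1)`, where `z = ν_j
+ w - m` and `w` collects the other exponents and `D`. The radial integral over `t < 1` is `1 / z`
for `Re z > 0`; that over `t ≥ 1` is `-1 / z` for `Re z < 0`. The half-planes are disjoint, but the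
continuations are opposite and `J m` is common to both, so every sector cancels identically
(`Scaleless.exists_sector_continuation`).

The slice integrals need convergence. Since `a` has full column rank, `U` is at least a constant
times the `L`-th power of the smallest parameter (`exists_mul_pow_le_U`). Hence powers of `U` and
the entries of `M⁻¹` grow on the unit box at most like a power of `(∏ α_e)⁻¹`, which large `Re ν_i`,
`i ≠ j`, absorb.

Uniqueness of the value is a matter of identity theorems: any admissible continuation `P_j / Q_j`
has `P_j = 0`, and entire functions have no zero divisors. -/

open MeasureTheory Set

/-! ### Radial integration over primary sectors -/

/-- Polar integration over a union of slices of a primary sector: for a function that is homogeneous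
of degree `s` on the positive orthant, the radial integral factors out. -/
theorem integrableOn_sector_of_homogeneous {n : ℕ} (j : Fin (n + 1)) {T : Set ℝ}
    (hT : MeasurableSet T) (hT0 : T ⊆ Ioi 0) {h : (Fin (n + 1) → ℝ) → ℂ} (hm : Measurable h) {s : ℂ}
    (hh : ∀ t : ℝ, 0 < t → ∀ α : Fin (n + 1) → ℝ, (∀ i, 0 < α i) → h (t • α) = (t : ℂ) ^ s * h α)
    (hβ : IntegrableOn (fun β : Fin n → ℝ => h (j.insertNth (α := fun _ => ℝ) 1 β))
      (univ.pi fun _ => Ioc 0 1))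
    (hs : IntegrableOn (fun t : ℝ => (t : ℂ) ^ (s + n)) T) :
    IntegrableOn h {α | (∀ i, 0 < α i) ∧ (∀ i, α i ≤ α j) ∧ α j ∈ T} ∧
      ∫ α in {α | (∀ i, 0 < α i) ∧ (∀ i, α i ≤ α j) ∧ α j ∈ T}, h α =
        (∫ t in T, (t : ℂ) ^ (s + n)) *
          ∫ β in univ.pi fun _ : Fin n => Ioc (0 : ℝ) 1, h (j.insertNth (α := fun _ => ℝ) 1 β) := by
  set S : Set (Fin (n + 1) → ℝ) := {α | (∀ i, 0 < α i) ∧ (∀ i, α i ≤ α j) ∧ α j ∈ T} with hS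
  have hSm : MeasurableSet S := by
    refine MeasurableSet.inter (s₁ := {α : Fin (n + 1) → ℝ | ∀ i, 0 < α i}) ?_
      (MeasurableSet.inter (s₁ := {α : Fin (n + 1) → ℝ | ∀ i, α i ≤ α j}) ?_ (measurable_pi_apply j hT))
    · rw [ofPred_forall]
      exact MeasurableSet.iInter fun i => measurableSet_lt measurable_const (measurable_pi_apply i)
    · rw [ofPred_forall]
      exact MeasurableSet.iInter fun i =>
        measurableSet_le (measurable_pi_apply i) (measurable_pi_apply j)
  have hBm : MeasurableSet (univ.pi fun _ : Fin n => Ioc (0 : ℝ) 1) :=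
    MeasurableSet.univ_pi fun _ => measurableSet_Ioc
  set K : (Fin n → ℝ) → ℂ := (univ.pi fun _ => Ioc (0 : ℝ) 1).indicator
    fun β => h (j.insertNth (α := fun _ => ℝ) 1 β) with hK
  have hKi : Integrable K := (integrable_indicator_iff hBm).2 hβ
  set e := MeasurableEquiv.piFinSuccAbove (fun _ : Fin (n + 1) => ℝ) j with he
  have hep : MeasurePreserving e.symm := (volume_preserving_piFinSuccAbove (fun _ => ℝ) j).symm
  -- In the coordinates `t = α_j` and `x` for the others, the sector is `t ∈ T` with `t⁻¹ • x` in
  -- the unit box; homogeneity then separates the variables.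
  have key : ∀ t : ℝ, ∀ x : Fin n → ℝ, S.indicator h (e.symm (t, x)) =
      T.indicator (fun t : ℝ => (t : ℂ) ^ s) t * K (t⁻¹ • x) := by
    intro t x
    have hex : e.symm (t, x) = j.insertNth (α := fun _ => ℝ) t x := rfl
    by_cases ht : t ∈ T
    · have ht0 : 0 < t := hT0 ht
      have hsc : j.insertNth (α := fun _ => ℝ) t x
          = t • j.insertNth (α := fun _ => ℝ) 1 (t⁻¹ • x) := by
        funext i
        refine j.succAboveCases ?_ (fun i => ?_) i
        · simp
        · simp [ht0.ne']
      rw [indicator_of_mem ht, hK]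
      by_cases hx : t⁻¹ • x ∈ univ.pi fun _ : Fin n => Ioc (0 : ℝ) 1
      · have hx' : ∀ i, 0 < t⁻¹ * x i ∧ t⁻¹ * x i ≤ 1 := fun i => hx i (mem_univ i)
        have hpos : ∀ i, 0 < j.insertNth (α := fun _ => ℝ) 1 (t⁻¹ • x) i := by
          intro i
          refine j.succAboveCases ?_ (fun i => ?_) i
          · simp
          · simpa using (hx' i).1
        have hmem : e.symm (t, x) ∈ S := by
          rw [hex, hS]
          refine ⟨fun i => ?_, fun i => ?_, by simpa using ht⟩
          · rw [hsc]; exact mul_pos ht0 (hpos i)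
          · refine j.succAboveCases ?_ (fun i => ?_) i
            · simp
            · have := (hx' i).2
              rw [inv_mul_le_iff₀ ht0] at this
              simpa using this
        rw [indicator_of_mem hmem, indicator_of_mem hx, hex, hsc, hh t ht0 _ hpos]
      · rw [indicator_of_notMem hx, mul_zero, indicator_of_notMem]
        rintro ⟨h1, h2, -⟩
        refine hx fun i _ => ⟨?_, ?_⟩
        · have := h1 (j.succAbove i)
          rw [hex, Fin.insertNth_apply_succAbove] at this
          exact mul_pos (inv_pos.2 ht0) this
        · have := h2 (j.succAbove i)
          rw [hex, Fin.insertNth_apply_succAbove, Fin.insertNth_apply_same] at this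
          change t⁻¹ * x i ≤ 1
          rw [inv_mul_le_iff₀ ht0]
          simpa using this
    · rw [indicator_of_notMem ht, zero_mul, indicator_of_notMem]
      rintro ⟨-, -, h3⟩
      rw [hex, Fin.insertNth_apply_same] at h3
      exact ht h3
  -- The extra `t ^ n` is the Jacobian of `x = t • β`.
  have hpow : ∀ t ∈ T, (t : ℂ) ^ (s + n) = (t : ℂ) ^ s * ((t ^ n : ℝ) : ℂ) := by
    intro t ht
    rw [Complex.cpow_add _ _ (by exact_mod_cast (hT0 ht).ne'), Complex.cpow_natCast]
    push_cast; rfl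
  have hnorm : ∀ t, ∫ x, ‖S.indicator h (e.symm (t, x))‖ =
      T.indicator (fun t : ℝ => ‖(t : ℂ) ^ (s + n)‖) t * ∫ x, ‖K x‖ := by
    intro t
    simp_rw [key, norm_mul]
    by_cases ht : t ∈ T
    · have ht0 : 0 < t := hT0 ht
      rw [integral_const_mul, Measure.integral_comp_inv_smul_of_nonneg volume (fun x => ‖K x‖) ht0.le,
        indicator_of_mem ht, indicator_of_mem ht, hpow t ht, norm_mul, Complex.norm_real,
        Real.norm_of_nonneg (by positivity), Module.finrank_fin_fun, smul_eq_mul, mul_assoc]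
    · simp [indicator_of_notMem ht]
  have hval : ∀ t, ∫ x, S.indicator h (e.symm (t, x)) =
      T.indicator (fun t : ℝ => (t : ℂ) ^ (s + n)) t * ∫ x, K x := by
    intro t
    simp_rw [key]
    by_cases ht : t ∈ T
    · have ht0 : 0 < t := hT0 ht
      rw [integral_const_mul, Measure.integral_comp_inv_smul_of_nonneg volume K ht0.le,
        indicator_of_mem ht, indicator_of_mem ht, hpow t ht, Module.finrank_fin_fun,
        Complex.real_smul, mul_assoc]
    · simp [indicator_of_notMem ht]
  have hint : Integrable (fun z : ℝ × (Fin n → ℝ) => S.indicator h (e.symm z))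
      (volume.prod volume) := by
    have hmeas : Measurable fun z : ℝ × (Fin n → ℝ) => S.indicator h (e.symm z) :=
      (hm.indicator hSm).comp e.symm.measurable
    rw [integrable_prod_iff hmeas.aestronglyMeasurable]
    refine ⟨Filter.Eventually.of_forall fun t => ?_, ?_⟩
    · simp_rw [key]
      by_cases ht : t ∈ T
      · exact (hKi.comp_smul (inv_ne_zero (hT0 ht).ne')).const_mul _
      · simp [indicator_of_notMem ht]
    · simp_rw [hnorm]
      exact ((integrable_indicator_iff hT).2 hs.norm).mul_const _
  constructor
  · rw [← integrable_indicator_iff hSm]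
    exact (hep.integrable_comp_emb e.symm.measurableEmbedding).1 hint
  · rw [← integral_indicator hSm, ← hep.integral_comp e.symm.measurableEmbedding]
    change ∫ z, S.indicator h (e.symm z) ∂(volume.prod volume) = _
    rw [integral_prod _ hint]
    simp_rw [hval]
    rw [integral_mul_const, integral_indicator hT, hK, integral_indicator hBm]

/-! ### Identity theorems -/

/-- Two meromorphic functions on `ℂ` that agree on a nonempty open set agree on a codiscrete set. -/
theorem MeromorphicOn.eventuallyEq_codiscrete_of_eqOn {f g : ℂ → ℂ} (hf : MeromorphicOn f univ)
    (hg : MeromorphicOn g univ) {V : Set ℂ} (hV : IsOpen V) (hne : V.Nonempty) (h : EqOn f g V) :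
    f =ᶠ[Filter.codiscrete ℂ] g := by
  have hd : MeromorphicOn (f - g) univ := hf.sub hg
  obtain ⟨w, hw⟩ := hne
  have htop : meromorphicOrderAt (f - g) w = ⊤ := by
    rw [meromorphicOrderAt_eq_top_iff]
    refine Filter.Eventually.filter_mono nhdsWithin_le_nhds ?_
    filter_upwards [hV.mem_nhds hw] with z hz
    simp [h hz]
  -- On the connected set `ℂ`, infinite order at one point forces infinite order everywhere.
  have hall := (hd.exists_meromorphicOrderAt_ne_top_iff_forall isConnected_univ).not
  have hall' : ∀ u : ℂ, meromorphicOrderAt (f - g) u = ⊤ := by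
    have := hall.2 (fun H => H ⟨w, mem_univ w⟩ htop)
    push Not at this
    exact fun u => this ⟨u, mem_univ u⟩
  rw [Filter.EventuallyEq, Filter.Eventually, mem_codiscrete]
  intro x
  rw [Filter.disjoint_principal_right, compl_compl]
  filter_upwards [meromorphicOrderAt_eq_top_iff.1 (hall' x)] with z hz
  exact sub_eq_zero.1 hz

/-- A continuous function on `ℂ` that vanishes on a codiscrete set vanishes. -/
theorem Continuous.eq_zero_of_codiscrete {f : ℂ → ℂ} (hf : Continuous f)
    (h : ∀ᶠ z in Filter.codiscrete ℂ, f z = 0) (z : ℂ) : f z = 0 := by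
  have h1 := mem_codiscrete.1 h z
  rw [Filter.disjoint_principal_right, compl_compl] at h1
  have h2 : Filter.Tendsto f (nhdsWithin z {z}ᶜ) (nhds (f z)) :=
    hf.continuousAt.tendsto.mono_left nhdsWithin_le_nhds
  have h3 : Filter.Tendsto f (nhdsWithin z {z}ᶜ) (nhds 0) :=
    tendsto_const_nhds.congr' (by filter_upwards [h1] with w hw using hw.symm)
  exact tendsto_nhds_unique h2 h3

/-- An entire function on a complex normed space that vanishes near a point vanishes. -/
theorem Differentiable.eq_zero_of_eventually {W : Type*} [NormedAddCommGroup W] [NormedSpace ℂ W]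
    {f : W → ℂ} (hf : Differentiable ℂ f) {w : W} (h : ∀ᶠ z in nhds w, f z = 0) : f = 0 := by
  funext z
  -- Restriction to the complex line through `w` and `z` reduces the claim to one variable.
  set l : ℂ → W := fun t => w + t • (z - w) with hl
  have hlc : Differentiable ℂ l := by rw [hl]; fun_prop
  have ha : AnalyticOnNhd ℂ (f ∘ l) univ := (hf.comp hlc).differentiableOn.analyticOnNhd isOpen_univ
  have h0 : (f ∘ l) =ᶠ[nhds 0] 0 := by
    have : Filter.Tendsto l (nhds 0) (nhds w) := by
      simpa [hl] using hlc.continuous.tendsto 0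
    exact this.eventually h
  have := ha.eqOn_zero_of_preconnected_of_eventuallyEq_zero isPreconnected_univ (mem_univ 0) h0
    (mem_univ 1)
  simpa [hl] using this

/-- The entire functions on a complex normed space have no zero divisors. -/
theorem Differentiable.eq_zero_of_mul_eq_zero {W : Type*} [NormedAddCommGroup W] [NormedSpace ℂ W]
    {f g : W → ℂ} (hf : Differentiable ℂ f) (hg : Differentiable ℂ g) (hne : g ≠ 0)
    (h : ∀ z, f z * g z = 0) : f = 0 := by
  obtain ⟨w, hw⟩ := Function.ne_iff.1 hne
  refine hf.eq_zero_of_eventually (w := w) ?_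
  filter_upwards [hg.continuous.continuousAt.eventually_ne hw] with z hz
  exact (mul_eq_zero.1 (h z)).resolve_right hz

namespace FeynmanIntegral

variable {L E p : ℕ}

/-! ### The first Symanzik polynomial -/

theorem M_smul (F : FeynmanIntegral L E p) (t : ℝ) (α : Fin p → ℝ) :
    F.M (t • α) = t • F.M α := by
  ext l l'
  simp [M, Finset.mul_sum, mul_assoc]

theorem U_smul (F : FeynmanIntegral L E p) (t : ℝ) (α : Fin p → ℝ) :
    F.U (t • α) = t ^ L * F.U α := by
  simp [U, M_smul]

theorem continuous_M (F : FeynmanIntegral L E p) : Continuous F.M := by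
  refine continuous_matrix fun l l' => ?_
  unfold M
  fun_prop

theorem continuous_U (F : FeynmanIntegral L E p) : Continuous F.U :=
  F.continuous_M.matrix_det

theorem isHermitian_M (F : FeynmanIntegral L E p) (α : Fin p → ℝ) : (F.M α).IsHermitian := by
  ext l l'
  simp only [M, Matrix.conjTranspose_apply, star_trivial]
  exact Finset.sum_congr rfl fun e _ => by ring

theorem dotProduct_M_mulVec (F : FeynmanIntegral L E p) (α : Fin p → ℝ) (x : Fin L → ℝ) :
    x ⬝ᵥ (F.M α).mulVec x = ∑ e, α e * (∑ l, F.a e l * x l) ^ 2 := by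
  simp only [dotProduct, Matrix.mulVec, M, Finset.mul_sum, Finset.sum_mul, sq]
  rw [Finset.sum_congr rfl fun l _ => Finset.sum_comm, Finset.sum_comm]
  refine Finset.sum_congr rfl fun e _ => ?_
  rw [Finset.sum_comm]
  exact Finset.sum_congr rfl fun l _ => Finset.sum_congr rfl fun l' _ => by ring

/-- The first Symanzik polynomial is bounded below by a power of the smallest parameter. -/
theorem exists_mul_pow_le_U (F : FeynmanIntegral L E p) :
    ∃ c : ℝ, 0 < c ∧ ∀ (α : Fin p → ℝ) (m : ℝ), 0 < m → (∀ e, m ≤ α e) → c * m ^ L ≤ F.U α := by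
  set A : Matrix (Fin p) (Fin L) ℝ := F.a.map (Int.cast : ℤ → ℝ) with hA
  -- Rank `L` means that `A` is injective, hence bounded below: `‖x‖ ≤ K ‖A x‖`.
  have hinj : LinearMap.ker (Matrix.toLpLin 2 2 A) = ⊥ := by
    have hk : LinearMap.ker A.mulVecLin = ⊥ := by
      rw [← Submodule.finrank_eq_zero (R := ℝ)]
      have h1 := A.mulVecLin.finrank_range_add_finrank_ker
      have h2 : Module.finrank ℝ (LinearMap.range A.mulVecLin) = L := F.rank_a
      rw [h2, Module.finrank_fin_fun] at h1
      omega
    rw [LinearMap.ker_eq_bot'] at hk ⊢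
    intro x hx
    have : x.ofLp = 0 := hk x.ofLp (by simpa [Matrix.toLpLin_apply] using hx)
    ext i
    simp [this]
  obtain ⟨K, hK0, hK⟩ := LinearMap.exists_antilipschitzWith _ hinj
  have hKp : (0 : ℝ) < K := by exact_mod_cast hK0
  refine ⟨(((K : ℝ) ^ 2)⁻¹) ^ L, by positivity, fun α m hm hα => ?_⟩
  -- For a unit eigenvector `v` the eigenvalue is `∑ α_e (A v)_e² ≥ m ‖A v‖² ≥ m / K²`; the
  -- determinant is a product of `L` of these.
  have hev : ∀ i, ((K : ℝ) ^ 2)⁻¹ * m ≤ (F.isHermitian_M α).eigenvalues i := by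
    intro i
    set v := (F.isHermitian_M α).eigenvectorBasis i with hv
    have hv1 : ‖v‖ = 1 := (F.isHermitian_M α).eigenvectorBasis.orthonormal.1 i
    have h1 : ‖v‖ ≤ K * ‖Matrix.toLpLin 2 2 A v‖ := by
      have := hK.le_mul_dist v 0
      simpa using this
    have h2 : ‖Matrix.toLpLin 2 2 A v‖ ^ 2 = ∑ e, (∑ l, F.a e l * v l) ^ 2 := by
      rw [EuclideanSpace.real_norm_sq_eq]
      simp [Matrix.toLpLin_apply, Matrix.mulVec, dotProduct, hA]
    rw [(F.isHermitian_M α).eigenvalues_eq i]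
    simp only [star_trivial, RCLike.re_to_real]
    rw [dotProduct_M_mulVec]
    have h3 : m * ∑ e, (∑ l, F.a e l * v l) ^ 2 ≤ ∑ e, α e * (∑ l, F.a e l * v l) ^ 2 := by
      rw [Finset.mul_sum]
      exact Finset.sum_le_sum fun e _ => mul_le_mul_of_nonneg_right (hα e) (sq_nonneg _)
    refine le_trans ?_ h3
    rw [← h2, mul_comm]
    refine mul_le_mul_of_nonneg_left ?_ hm.le
    rw [inv_le_iff_one_le_mul₀ (by positivity), ← mul_pow]
    rw [hv1] at h1
    exact one_le_pow₀ (by linarith)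
  have hdet : F.U α = ∏ i, (F.isHermitian_M α).eigenvalues i := by
    have := (F.isHermitian_M α).det_eq_prod_eigenvalues
    simpa [U] using this
  rw [hdet, ← mul_pow]
  calc (((K : ℝ) ^ 2)⁻¹ * m) ^ L = ∏ _i : Fin L, ((K : ℝ) ^ 2)⁻¹ * m := by simp
    _ ≤ _ := Finset.prod_le_prod (fun _ _ => by positivity) fun i _ => hev i

theorem U_pos [NeZero p] (F : FeynmanIntegral L E p) {α : Fin p → ℝ} (hα : ∀ e, 0 < α e) :
    0 < F.U α := by
  obtain ⟨c, hc, h⟩ := F.exists_mul_pow_le_U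
  obtain ⟨e, he⟩ := Finite.exists_min α
  exact (mul_pos hc (pow_pos (hα e) L)).trans_le (h α (α e) (hα e) he)

/-! ### Monomial bounds on the unit box -/

/-- A measurable function that is bounded on the unit box by an inverse power of the product of the
coordinates. -/
def HasMonomialBound (f : (Fin p → ℝ) → ℂ) : Prop :=
  Measurable f ∧ ∃ C : ℝ, 0 ≤ C ∧ ∃ K : ℕ, ∀ α : Fin p → ℝ, (∀ e, α e ∈ Ioc (0 : ℝ) 1) →
    ‖f α‖ ≤ C * (∏ e, α e)⁻¹ ^ K

theorem one_le_inv_prod {α : Fin p → ℝ} (hα : ∀ e, α e ∈ Ioc (0 : ℝ) 1) : 1 ≤ (∏ e, α e)⁻¹ :=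
  (one_le_inv₀ (Finset.prod_pos fun e _ => (hα e).1)).2
    (Finset.prod_le_one (fun e _ => (hα e).1.le) fun e _ => (hα e).2)

theorem prod_le_apply {α : Fin p → ℝ} (hα : ∀ e, α e ∈ Ioc (0 : ℝ) 1) (e : Fin p) :
    ∏ e, α e ≤ α e := by
  rw [← Finset.mul_prod_erase _ _ (Finset.mem_univ e)]
  exact mul_le_of_le_one_right (hα e).1.le
    (Finset.prod_le_one (fun i _ => (hα i).1.le) fun i _ => (hα i).2)

theorem _root_.Continuous.hasMonomialBound {f : (Fin p → ℝ) → ℂ} (hf : Continuous f) :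
    HasMonomialBound f := by
  refine ⟨hf.measurable, ?_⟩
  obtain ⟨C, hC⟩ := (isCompact_Icc (a := (0 : Fin p → ℝ)) (b := 1)).exists_bound_of_continuousOn
    hf.continuousOn
  refine ⟨max C 0, le_max_right _ _, 0, fun α hα => ?_⟩
  rw [pow_zero, mul_one]
  exact (hC α ⟨fun e => (hα e).1.le, fun e => (hα e).2⟩).trans (le_max_left _ _)

theorem HasMonomialBound.add {f g : (Fin p → ℝ) → ℂ} (hf : HasMonomialBound f)
    (hg : HasMonomialBound g) : HasMonomialBound fun α => f α + g α := by
  obtain ⟨mf, C, hC, K, h⟩ := hf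
  obtain ⟨mg, C', hC', K', h'⟩ := hg
  refine ⟨mf.add mg, C + C', by positivity, K + K', fun α hα => ?_⟩
  have h1 := one_le_inv_prod hα
  calc ‖f α + g α‖ ≤ ‖f α‖ + ‖g α‖ := norm_add_le _ _
    _ ≤ C * (∏ e, α e)⁻¹ ^ K + C' * (∏ e, α e)⁻¹ ^ K' := add_le_add (h α hα) (h' α hα)
    _ ≤ C * (∏ e, α e)⁻¹ ^ (K + K') + C' * (∏ e, α e)⁻¹ ^ (K + K') := by
      gcongr <;> first | exact h1 | omega
    _ = _ := by ring

theorem HasMonomialBound.mul {f g : (Fin p → ℝ) → ℂ} (hf : HasMonomialBound f)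
    (hg : HasMonomialBound g) : HasMonomialBound fun α => f α * g α := by
  obtain ⟨mf, C, hC, K, h⟩ := hf
  obtain ⟨mg, C', hC', K', h'⟩ := hg
  refine ⟨mf.mul mg, C * C', by positivity, K + K', fun α hα => ?_⟩
  have h1 := one_le_inv_prod hα
  rw [norm_mul, pow_add, mul_mul_mul_comm]
  exact mul_le_mul (h α hα) (h' α hα) (norm_nonneg _) ((norm_nonneg _).trans (h α hα))

theorem hasMonomialBound_sum {ι : Type*} (s : Finset ι) {f : ι → (Fin p → ℝ) → ℂ}
    (hf : ∀ i ∈ s, HasMonomialBound (f i)) : HasMonomialBound fun α => ∑ i ∈ s, f i α := by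
  classical
  induction s using Finset.induction_on with
  | empty => simpa using continuous_const.hasMonomialBound
  | insert i s hi ih =>
    simp_rw [Finset.sum_insert hi]
    exact (hf i (Finset.mem_insert_self i s)).add
      (ih fun k hk => hf k (Finset.mem_insert_of_mem hk))

/-- For `Re z ≥ 0` boundedness of the polynomial `U` on the box suffices. For `Re z < 0` the lower
bound on `U` is used with `m = ∏ α_e`, which lies below every coordinate. Rounding exponents up is
harmless because `(∏ α_e)⁻¹ ≥ 1`. -/
theorem hasMonomialBound_U_cpow [NeZero p] (F : FeynmanIntegral L E p) (z : ℂ) :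
    HasMonomialBound fun α => (F.U α : ℂ) ^ z := by
  have hUm : Measurable fun α => (F.U α : ℂ) :=
    Complex.measurable_ofReal.comp F.continuous_U.measurable
  refine ⟨hUm.pow_const z, ?_⟩
  rcases le_or_gt 0 z.re with hz | hz
  · obtain ⟨-, C, hC, K, h⟩ := (Complex.continuous_ofReal.comp F.continuous_U).hasMonomialBound
    refine ⟨C ^ z.re, by positivity, K * ⌈z.re⌉₊, fun α hα => ?_⟩
    have hU := F.U_pos fun e => (hα e).1
    have h1 := one_le_inv_prod hα
    have h2 := h α hα
    rw [Function.comp_apply, Complex.norm_real, Real.norm_of_nonneg hU.le] at h2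
    rw [Complex.norm_cpow_eq_rpow_re_of_pos hU, pow_mul, ← Real.rpow_natCast _ ⌈z.re⌉₊]
    calc F.U α ^ z.re ≤ (C * (∏ e, α e)⁻¹ ^ K) ^ z.re := Real.rpow_le_rpow hU.le h2 hz
      _ = C ^ z.re * ((∏ e, α e)⁻¹ ^ K) ^ z.re := Real.mul_rpow hC (by positivity)
      _ ≤ _ := mul_le_mul_of_nonneg_left (Real.rpow_le_rpow_of_exponent_le (one_le_pow₀ h1)
          (Nat.le_ceil _)) (by positivity)
  · obtain ⟨c, hc, h⟩ := F.exists_mul_pow_le_U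
    refine ⟨c⁻¹ ^ (-z.re), by positivity, L * ⌈-z.re⌉₊, fun α hα => ?_⟩
    have hU := F.U_pos fun e => (hα e).1
    have h1 := one_le_inv_prod hα
    have hp : 0 < ∏ e, α e := Finset.prod_pos fun e _ => (hα e).1
    have h2 : (F.U α)⁻¹ ≤ c⁻¹ * (∏ e, α e)⁻¹ ^ L := by
      rw [inv_pow, ← mul_inv]
      exact inv_anti₀ (by positivity) (h α _ hp (prod_le_apply hα))
    rw [Complex.norm_cpow_eq_rpow_re_of_pos hU, pow_mul, ← Real.rpow_natCast _ ⌈-z.re⌉₊]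
    calc F.U α ^ z.re = (F.U α)⁻¹ ^ (-z.re) := by
          rw [Real.rpow_neg (by positivity), Real.inv_rpow hU.le, inv_inv]
      _ ≤ (c⁻¹ * (∏ e, α e)⁻¹ ^ L) ^ (-z.re) :=
          Real.rpow_le_rpow (by positivity) h2 (by linarith)
      _ = c⁻¹ ^ (-z.re) * ((∏ e, α e)⁻¹ ^ L) ^ (-z.re) :=
          Real.mul_rpow (by positivity) (by positivity)
      _ ≤ _ := mul_le_mul_of_nonneg_left (Real.rpow_le_rpow_of_exponent_le (one_le_pow₀ h1)
          (Nat.le_ceil _)) (by positivity)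

/-- By Cramer's rule `M⁻¹` is the polynomial adjugate divided by `U`. -/
theorem hasMonomialBound_M_inv [NeZero p] (F : FeynmanIntegral L E p) (i j : Fin L) :
    HasMonomialBound fun α => (((F.M α)⁻¹ i j : ℝ) : ℂ) := by
  have h1 : Continuous fun α => (((F.M α).adjugate i j : ℝ) : ℂ) :=
    Complex.continuous_ofReal.comp (F.continuous_M.matrix_adjugate.matrix_elem i j)
  have h2 := (F.hasMonomialBound_U_cpow (-1)).mul h1.hasMonomialBound
  refine (iff_of_eq (congrArg _ (funext fun α => ?_))).1 h2
  simp [Matrix.inv_def, U, Complex.cpow_neg_one]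

theorem M_smul_inv [NeZero p] (F : FeynmanIntegral L E p) {t : ℝ} (ht : 0 < t) {α : Fin p → ℝ}
    (hα : ∀ e, 0 < α e) : (F.M (t • α))⁻¹ = t⁻¹ • (F.M α)⁻¹ := by
  refine Matrix.inv_eq_left_inv ?_
  rw [M_smul, Matrix.smul_mul, Matrix.mul_smul, smul_smul, inv_mul_cancel₀ ht.ne', one_smul]
  exact Matrix.nonsing_inv_mul _ (F.U_pos hα).ne'.isUnit

/-! ### Gaussian averages at vanishing mean -/

/-- `laplacian` as a linear map. -/
noncomputable def laplacianLM (F : FeynmanIntegral L E p) (D : ℂ) (i j : Fin L) :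
    MvPolynomial (LoopDot L E) ℂ →ₗ[ℂ] MvPolynomial (LoopDot L E) ℂ where
  toFun := F.laplacian D i j
  map_add' N N' := by
    simp only [laplacian, map_add, mul_add, Finset.sum_add_distrib]
    ring
  map_smul' c N := by
    simp only [laplacian, Derivation.map_smul, mul_smul_comm, Finset.smul_sum, smul_add, RingHom.id_apply]

/-- `heat` as a linear map. -/
noncomputable def heatLM (F : FeynmanIntegral L E p) (D : ℂ) (α : Fin p → ℝ) :
    MvPolynomial (LoopDot L E) ℂ →ₗ[ℂ] MvPolynomial (LoopDot L E) ℂ :=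
  ∑ i, ∑ j, (Complex.I / 4 * (((F.M α)⁻¹ i j : ℝ) : ℂ)) • F.laplacianLM D i j

theorem heat_eq_heatLM (F : FeynmanIntegral L E p) (D : ℂ) (α : Fin p → ℝ) :
    F.heat D α = F.heatLM D α := by
  funext N
  simp [heat, heatLM, laplacianLM, MvPolynomial.smul_eq_C_mul]

/-- Linearity moves all dependence of one `heat` step on `α` into the scalars `(M⁻¹)_{ij}`. The
bound and the scaling law below then follow by induction on `m`, with `N` replaced by its
Laplacians. -/
theorem eval_heat_iterate_succ (F : FeynmanIntegral L E p) (D : ℂ) (α : Fin p → ℝ)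
    (x : LoopDot L E → ℂ) (m : ℕ) (N : MvPolynomial (LoopDot L E) ℂ) :
    MvPolynomial.eval x ((F.heat D α)^[m + 1] N) =
      ∑ i, ∑ j, Complex.I / 4 * (((F.M α)⁻¹ i j : ℝ) : ℂ) *
        MvPolynomial.eval x ((F.heat D α)^[m] (F.laplacian D i j N)) := by
  simp only [heat_eq_heatLM, Function.iterate_succ_apply, ← Module.End.pow_apply]
  have h : F.heatLM D α N = ∑ i, ∑ j,
      (Complex.I / 4 * (((F.M α)⁻¹ i j : ℝ) : ℂ)) • F.laplacian D i j N := by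
    simp [heatLM, laplacianLM]
  rw [h]
  simp only [map_sum, map_smul, MvPolynomial.smul_eval]

theorem hasMonomialBound_eval_heat_iterate [NeZero p] (F : FeynmanIntegral L E p) (D : ℂ)
    (x : LoopDot L E → ℂ) (m : ℕ) (N : MvPolynomial (LoopDot L E) ℂ) :
    HasMonomialBound fun α => MvPolynomial.eval x ((F.heat D α)^[m] N) := by
  induction m generalizing N with
  | zero =>
    simp only [Function.iterate_zero, id_eq]
    exact continuous_const.hasMonomialBound
  | succ m ih =>
    simp_rw [eval_heat_iterate_succ]
    exact hasMonomialBound_sum _ fun i _ => hasMonomialBound_sum _ fun j _ =>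
      (continuous_const.hasMonomialBound.mul (F.hasMonomialBound_M_inv i j)).mul (ih _)

theorem eval_heat_iterate_smul [NeZero p] (F : FeynmanIntegral L E p) (D : ℂ)
    (x : LoopDot L E → ℂ) (m : ℕ) (N : MvPolynomial (LoopDot L E) ℂ) {t : ℝ} (ht : 0 < t)
    {α : Fin p → ℝ} (hα : ∀ e, 0 < α e) :
    MvPolynomial.eval x ((F.heat D (t • α))^[m] N) =
      (t : ℂ)⁻¹ ^ m * MvPolynomial.eval x ((F.heat D α)^[m] N) := by
  induction m generalizing N with
  | zero => simp
  | succ m ih =>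
    simp_rw [eval_heat_iterate_succ, ih, F.M_smul_inv ht hα, Finset.mul_sum]
    refine Finset.sum_congr rfl fun i _ => Finset.sum_congr rfl fun j _ => ?_
    simp only [Matrix.smul_apply, smul_eq_mul, Complex.ofReal_mul, Complex.ofReal_inv]
    ring

theorem Scaleless.Fpoly_eq_zero {F : FeynmanIntegral L E p} (hF : F.Scaleless) (α : Fin p → ℝ) :
    F.Fpoly α = 0 := by
  have h : F.dot = 0 := Matrix.ext hF.1
  simp [Fpoly, h, hF.2]

theorem Scaleless.meanDot_eq_zero {F : FeynmanIntegral L E p} (hF : F.Scaleless)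
    (α : Fin p → ℝ) : F.meanDot α = 0 := by
  have h : F.dot = 0 := Matrix.ext hF.1
  funext v
  rcases v with ⟨a, b | e⟩ <;> simp [meanDot, h]

/-! ### Homogeneous terms of the integrand -/

/-- The part of the Schwinger integrand that comes from the `m`-th term of the Gaussian average at
vanishing mean, without the factors that do not depend on the Schwinger parameters. -/
noncomputable def schwingerTerm (F : FeynmanIntegral L E p) (N : MvPolynomial (LoopDot L E) ℂ)
    (ν : Fin p → ℂ) (D : ℂ) (m : ℕ) (α : Fin p → ℝ) : ℂ :=
  (∏ e, (α e : ℂ) ^ (ν e - 1)) *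
    ((F.U α : ℂ) ^ (-D / 2) * MvPolynomial.eval 0 ((F.heat D α)^[m] N))

/-- The factors of the Schwinger integrand that do not depend on the Schwinger parameters. -/
noncomputable def schwingerPrefactor (F : FeynmanIntegral L E p) (ν : Fin p → ℂ) (D : ℂ) : ℂ :=
  Complex.exp ((Real.eulerMascheroniConstant : ℂ) * L * ((F.D₀ - D) / 2))
    * Complex.I ^ (∑ e, ν e - L * D / 2) * ∏ e, (Complex.Gamma (ν e))⁻¹

theorem Scaleless.integrand_eq {F : FeynmanIntegral L E p} (hF : F.Scaleless)
    (N : MvPolynomial (LoopDot L E) ℂ) (ν : Fin p → ℂ) (D : ℂ) (α : Fin p → ℝ) :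
    F.integrand N ν D α = ∑ m ∈ Finset.range (N.totalDegree + 1),
      F.schwingerPrefactor ν D * (m.factorial : ℂ)⁻¹ * F.schwingerTerm N ν D m α := by
  simp only [integrand, gaussianAverage, hF.Fpoly_eq_zero, hF.meanDot_eq_zero, schwingerPrefactor,
    schwingerTerm, zero_div, Complex.ofReal_zero, mul_zero, Complex.exp_zero, mul_one,
    Finset.prod_mul_distrib, Finset.mul_sum]
  exact Finset.sum_congr rfl fun m _ => by ring

theorem hasMonomialBound_schwinger [NeZero p] (F : FeynmanIntegral L E p)
    (N : MvPolynomial (LoopDot L E) ℂ) (D : ℂ) (m : ℕ) :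
    HasMonomialBound fun α => (F.U α : ℂ) ^ (-D / 2) *
      MvPolynomial.eval 0 ((F.heat D α)^[m] N) :=
  (F.hasMonomialBound_U_cpow _).mul (F.hasMonomialBound_eval_heat_iterate D 0 m N)

theorem measurable_prod_cpow (ν : Fin p → ℂ) :
    Measurable fun α : Fin p → ℝ => ∏ e, (α e : ℂ) ^ (ν e - 1) :=
  Finset.measurable_prod _ fun e _ =>
    (Complex.measurable_ofReal.comp (measurable_pi_apply e)).pow_const _

theorem measurable_schwingerTerm [NeZero p] (F : FeynmanIntegral L E p)
    (N : MvPolynomial (LoopDot L E) ℂ) (ν : Fin p → ℂ) (D : ℂ) (m : ℕ) :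
    Measurable (F.schwingerTerm N ν D m) :=
  (measurable_prod_cpow ν).mul (F.hasMonomialBound_schwinger N D m).1

/-- `U` has degree `L` and each `heat` step contributes one factor `M⁻¹` of degree `-1`. -/
theorem schwingerTerm_smul [NeZero p] (F : FeynmanIntegral L E p)
    (N : MvPolynomial (LoopDot L E) ℂ) (ν : Fin p → ℂ) (D : ℂ) (m : ℕ) {t : ℝ} (ht : 0 < t)
    {α : Fin p → ℝ} (hα : ∀ e, 0 < α e) :
    F.schwingerTerm N ν D m (t • α) =
      (t : ℂ) ^ (∑ e, (ν e - 1) - L * D / 2 - m) * F.schwingerTerm N ν D m α := by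
  have ht0 : (t : ℂ) ≠ 0 := by exact_mod_cast ht.ne'
  have h1 : ∏ e, (((t • α) e : ℝ) : ℂ) ^ (ν e - 1) =
      (t : ℂ) ^ (∑ e, (ν e - 1)) * ∏ e, (α e : ℂ) ^ (ν e - 1) := by
    have h : (t : ℂ) ^ (∑ e, (ν e - 1)) = ∏ e, (t : ℂ) ^ (ν e - 1) := by
      simp only [Complex.cpow_def_of_ne_zero ht0, Finset.mul_sum, Complex.exp_sum]
    rw [h, ← Finset.prod_mul_distrib]
    refine Finset.prod_congr rfl fun e _ => ?_
    rw [← Complex.mul_cpow_ofReal_nonneg ht.le (hα e).le]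
    simp
  have h2 : (F.U (t • α) : ℂ) ^ (-D / 2) =
      (t : ℂ) ^ (-(L * D / 2)) * (F.U α : ℂ) ^ (-D / 2) := by
    rw [U_smul, Complex.ofReal_mul, Complex.mul_cpow_ofReal_nonneg (by positivity) (F.U_pos hα).le,
      show -(L * D / 2) = ((L : ℝ) : ℂ) * (-D / 2) by push_cast; ring,
      Complex.cpow_mul_ofReal_nonneg ht.le]
    simp
  have h3 : (t : ℂ) ^ (-(m : ℂ)) = (t : ℂ)⁻¹ ^ m := by
    rw [Complex.cpow_neg, Complex.cpow_natCast, inv_pow]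
  rw [schwingerTerm, schwingerTerm, h1, h2, F.eval_heat_iterate_smul D 0 m N ht hα, ← h3,
    sub_eq_add_neg, sub_eq_add_neg _ (L * D / 2 : ℂ), Complex.cpow_add _ _ ht0,
    Complex.cpow_add _ _ ht0]
  ring

/-! ### Slice and radial integrals -/

/-- The slice `α_j = 1` of a primary sector is integrable when the exponents other than `ν_j` have
large real parts. -/
theorem HasMonomialBound.integrableOn_slice {n : ℕ} {g : (Fin (n + 1) → ℝ) → ℂ}
    (hg : HasMonomialBound g) (j : Fin (n + 1)) :
    ∃ R : ℝ, ∀ ν : Fin (n + 1) → ℂ, (∀ i, i ≠ j → R < (ν i).re) →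
      IntegrableOn (fun β : Fin n → ℝ =>
        (∏ e, (((j.insertNth (α := fun _ => ℝ) 1 β) e : ℝ) : ℂ) ^ (ν e - 1)) *
          g (j.insertNth (α := fun _ => ℝ) 1 β)) (univ.pi fun _ => Ioc 0 1) := by
  obtain ⟨hgm, C, hC, K, hK⟩ := hg
  -- `K` cancels the monomial bound; the `1` compensates the shift in `ν_e - 1`.
  refine ⟨K + 1, fun ν hν => ?_⟩
  have hins : Measurable fun β : Fin n → ℝ => j.insertNth (α := fun _ => ℝ) 1 β := by
    refine measurable_pi_lambda _ fun i => ?_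
    refine j.succAboveCases ?_ (fun i => ?_) i
    · simp
    · simpa using measurable_pi_apply i
  refine Measure.integrableOn_of_bounded (M := C) ?_
    (((measurable_prod_cpow ν).mul hgm).comp hins).aestronglyMeasurable ?_
  · rw [Real.volume_pi_Ioc]
    exact ENNReal.prod_ne_top fun _ _ => ENNReal.ofReal_ne_top
  · refine ae_restrict_of_forall_mem (MeasurableSet.univ_pi fun _ => measurableSet_Ioc) ?_
    intro β hβ
    have hα : ∀ e, j.insertNth (α := fun _ => ℝ) 1 β e ∈ Ioc (0 : ℝ) 1 := by
      intro e
      refine j.succAboveCases ?_ (fun i => ?_) e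
      · simp
      · simpa using hβ i (mem_univ i)
    set α := j.insertNth (α := fun _ => ℝ) 1 β with hαdef
    have hj : α j = 1 := by simp [hαdef]
    have hp : 0 < ∏ e, α e := Finset.prod_pos fun e _ => (hα e).1
    have h1 : ‖∏ e, (α e : ℂ) ^ (ν e - 1)‖ ≤ (∏ e, α e) ^ K := by
      rw [norm_prod, ← Finset.prod_pow]
      refine Finset.prod_le_prod (fun _ _ => norm_nonneg _) fun e _ => ?_
      -- The coordinate `α_j` equals `1` on the slice, so `ν_j` is unconstrained.
      by_cases he : e = j
      · rw [he, hj]; simp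
      · rw [Complex.norm_cpow_eq_rpow_re_of_pos (hα e).1, ← Real.rpow_natCast]
        refine Real.rpow_le_rpow_of_exponent_ge (hα e).1 (hα e).2 ?_
        have := hν e he
        simp only [Complex.sub_re, Complex.one_re]
        linarith
    rw [norm_mul]
    calc _ ≤ (∏ e, α e) ^ K * (C * (∏ e, α e)⁻¹ ^ K) :=
          mul_le_mul h1 (hK α hα) (norm_nonneg _) (by positivity)
      _ = C := by rw [mul_left_comm, ← mul_pow, mul_inv_cancel₀ hp.ne', one_pow, mul_one]

theorem _root_.integrableOn_cpow_sub_one_Ioo {z : ℂ} (hz : 0 < z.re) :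
    IntegrableOn (fun t : ℝ => (t : ℂ) ^ (z - 1)) (Ioo 0 1) ∧
      ∫ t in Ioo (0 : ℝ) 1, (t : ℂ) ^ (z - 1) = 1 / z := by
  have h : -1 < (z - 1).re := by simpa using hz
  have hz0 : z ≠ 0 := fun h0 => by simp [h0] at hz
  refine ⟨(intervalIntegral.integrableOn_Ioo_cpow_iff one_pos).2 h, ?_⟩
  rw [← integral_Ioc_eq_integral_Ioo, ← intervalIntegral.integral_of_le zero_le_one,
    integral_cpow (Or.inl h)]
  simp [hz0]

theorem _root_.integrableOn_cpow_sub_one_Ici {z : ℂ} (hz : z.re < 0) :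
    IntegrableOn (fun t : ℝ => (t : ℂ) ^ (z - 1)) (Ici 1) ∧
      ∫ t in Ici (1 : ℝ), (t : ℂ) ^ (z - 1) = -(1 / z) := by
  have h : (z - 1).re < -1 := by
    rw [Complex.sub_re, Complex.one_re]
    linarith
  refine ⟨(integrableOn_Ici_iff_integrableOn_Ioi).2 (integrableOn_Ioi_cpow_of_lt h one_pos), ?_⟩
  rw [integral_Ici_eq_integral_Ioi, integral_Ioi_cpow_of_lt h one_pos]
  simp [neg_div]

/-- Since `1 / Γ` is entire, the prefactor adds no poles in `ν_j`. -/
theorem differentiable_schwingerPrefactor_update (F : FeynmanIntegral L E p) (ν : Fin p → ℂ)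
    (D : ℂ) (j : Fin p) :
    Differentiable ℂ fun ζ => F.schwingerPrefactor (Function.update ν j ζ) D := by
  have hu : ∀ e, Differentiable ℂ fun ζ => Function.update ν j ζ e := by
    intro e
    by_cases he : e = j
    · subst he; simp
    · simp [Function.update_of_ne he]
  refine Differentiable.mul (Differentiable.mul (differentiable_const _) ?_) ?_
  · refine Differentiable.const_cpow ?_ (Or.inl Complex.I_ne_zero)
    exact (Differentiable.fun_sum fun e _ => hu e).sub_const _
  · exact Differentiable.fun_finsetProd fun e _ => Complex.differentiable_one_div_Gamma.comp (hu e)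

/-! ### Cancellation within each sector -/

/-- In a scaleless integral, the two parts of a primary sector have opposite continuations. -/
theorem Scaleless.exists_sector_continuation {n : ℕ} {F : FeynmanIntegral L E (n + 1)}
    (hF : F.Scaleless) (N : MvPolynomial (LoopDot L E) ℂ) (j : Fin (n + 1)) (D : ℂ) :
    ∃ R : ℝ, ∀ ν : Fin (n + 1) → ℂ, (∀ i, i ≠ j → R < (ν i).re) →
      ∃ G : ℂ → ℂ, MeromorphicOn G univ ∧
        (∃ r : ℝ, ∀ ζ : ℂ, r < ζ.re →
          IntegrableOn (F.integrand N (Function.update ν j ζ) D) (sectorUV j) ∧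
          G ζ = ∫ α in sectorUV j, F.integrand N (Function.update ν j ζ) D α) ∧
        (∃ r : ℝ, ∀ ζ : ℂ, ζ.re < r →
          IntegrableOn (F.integrand N (Function.update ν j ζ) D) (sectorIR j) ∧
          -G ζ = ∫ α in sectorIR j, F.integrand N (Function.update ν j ζ) D α) := by
  choose R hR using fun m : ℕ => (F.hasMonomialBound_schwinger N D m).integrableOn_slice j
  obtain ⟨R', hR'⟩ := ((Finset.range (N.totalDegree + 1)).image R).bddAbove
  refine ⟨R', fun ν hν => ?_⟩
  -- The Jacobian power `n` and the `n + 1` shifts in `∑ (ν_e - 1)` leave the radial exponent `ζ + w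
  -- - m - 1`.
  set w : ℂ := ∑ i, ν (j.succAbove i) - L * D / 2 with hw
  set J : ℕ → ℂ := fun m => ∫ β in univ.pi fun _ : Fin n => Ioc (0 : ℝ) 1,
    F.schwingerTerm N (Function.update ν j 1) D m (j.insertNth (α := fun _ => ℝ) 1 β) with hJ
  set c : ℂ → ℕ → ℂ := fun ζ m => F.schwingerPrefactor (Function.update ν j ζ) D *
    (m.factorial : ℂ)⁻¹ with hc
  have hslice : ∀ ζ m, (fun β : Fin n → ℝ => F.schwingerTerm N (Function.update ν j ζ) D m
      (j.insertNth (α := fun _ => ℝ) 1 β)) = fun β => F.schwingerTerm N (Function.update ν j 1) D m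
        (j.insertNth (α := fun _ => ℝ) 1 β) := by
    intro ζ m
    funext β
    simp [schwingerTerm, Fin.prod_univ_succAbove _ j]
  have hdeg : ∀ (ζ : ℂ) (m : ℕ),
      (∑ e, (Function.update ν j ζ e - 1) - L * D / 2 - m) + n = (ζ + w - m) - 1 := by
    intro ζ m
    simp [Fin.sum_univ_succAbove _ j, hw]
    ring
  have hsector : ∀ m ∈ Finset.range (N.totalDegree + 1), ∀ ζ : ℂ, ∀ T : Set ℝ, MeasurableSet T →
      T ⊆ Ioi 0 → IntegrableOn (fun t : ℝ => (t : ℂ) ^ ((ζ + w - m) - 1)) T →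
      IntegrableOn (F.schwingerTerm N (Function.update ν j ζ) D m)
          {α | (∀ i, 0 < α i) ∧ (∀ i, α i ≤ α j) ∧ α j ∈ T} ∧
        ∫ α in {α | (∀ i, 0 < α i) ∧ (∀ i, α i ≤ α j) ∧ α j ∈ T},
          F.schwingerTerm N (Function.update ν j ζ) D m α =
            (∫ t in T, (t : ℂ) ^ ((ζ + w - m) - 1)) * J m := by
    intro m hm ζ T hT hT0 hint
    have hβ := hR m (Function.update ν j ζ) fun i hi => by
      rw [Function.update_of_ne hi]
      exact (hR' (Finset.mem_coe.2 (Finset.mem_image_of_mem R hm))).trans_lt (hν i hi)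
    have := integrableOn_sector_of_homogeneous j hT hT0
      (F.measurable_schwingerTerm N (Function.update ν j ζ) D m)
      (fun t ht α hα => F.schwingerTerm_smul N _ D m ht hα) hβ (by rwa [hdeg])
    rwa [hdeg, hslice] at this
  have hsum : ∀ (ζ : ℂ) (S : Set (Fin (n + 1) → ℝ)) (I : ℕ → ℂ),
      (∀ m ∈ Finset.range (N.totalDegree + 1),
        IntegrableOn (F.schwingerTerm N (Function.update ν j ζ) D m) S ∧
        ∫ α in S, F.schwingerTerm N (Function.update ν j ζ) D m α = I m) →
      IntegrableOn (F.integrand N (Function.update ν j ζ) D) S ∧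
        ∑ m ∈ Finset.range (N.totalDegree + 1), c ζ m * I m =
          ∫ α in S, F.integrand N (Function.update ν j ζ) D α := by
    intro ζ S I h
    have he : F.integrand N (Function.update ν j ζ) D = fun α =>
        ∑ m ∈ Finset.range (N.totalDegree + 1),
          c ζ m * F.schwingerTerm N (Function.update ν j ζ) D m α :=
      funext fun α => hF.integrand_eq N _ D α
    rw [he]
    refine ⟨integrable_finsetSum _ fun m hm => (h m hm).1.const_mul _, ?_⟩
    rw [integral_finsetSum _ fun m hm => (h m hm).1.const_mul _]
    exact Finset.sum_congr rfl fun m hm => by rw [integral_const_mul, (h m hm).2]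
  -- The thresholds make `Re (ζ + w - m)` positive, respectively negative, for all `m` at once; the
  -- extreme cases are `m = N.totalDegree` and `m = 0`.
  refine ⟨fun ζ => ∑ m ∈ Finset.range (N.totalDegree + 1), c ζ m * (1 / (ζ + w - m) * J m),
    ?_, ⟨(N.totalDegree - w.re : ℝ), fun ζ hζ => ?_⟩, ⟨-w.re, fun ζ hζ => ?_⟩⟩
  · intro ζ _
    have hpre : MeromorphicAt (fun ζ => F.schwingerPrefactor (Function.update ν j ζ) D) ζ :=
      ((F.differentiable_schwingerPrefactor_update ν D j).analyticAt ζ).meromorphicAt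
    simp only [hc]
    fun_prop
  · have hset : sectorUV j = {α | (∀ i, 0 < α i) ∧ (∀ i, α i ≤ α j) ∧ α j ∈ Ioo (0 : ℝ) 1} := by
      ext α
      exact ⟨fun h => ⟨h.1, h.2.1, h.1 j, h.2.2⟩, fun h => ⟨h.1, h.2.1, h.2.2.2⟩⟩
    refine hsum ζ _ (fun m => 1 / (ζ + w - m) * J m) fun m hm => ?_
    have hm' : (m : ℝ) ≤ N.totalDegree := by
      exact_mod_cast Nat.lt_succ_iff.1 (Finset.mem_range.1 hm)
    obtain ⟨h1, h2⟩ := integrableOn_cpow_sub_one_Ioo (z := ζ + w - m) (by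
      simp only [Complex.sub_re, Complex.add_re, Complex.natCast_re]
      linarith)
    rw [hset, ← h2]
    exact hsector m hm ζ _ measurableSet_Ioo (fun t ht => ht.1) h1
  · have h := hsum ζ (sectorIR j) (fun m => -(1 / (ζ + w - m)) * J m) fun m hm => by
      obtain ⟨h1, h2⟩ := integrableOn_cpow_sub_one_Ici (z := ζ + w - m) (by
        have : (0 : ℝ) ≤ m := m.cast_nonneg
        simp only [Complex.sub_re, Complex.add_re, Complex.natCast_re]
        linarith)
      rw [← h2]
      exact hsector m hm ζ _ measurableSet_Ici (Ici_subset_Ioi.2 one_pos) h1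
    refine ⟨h.1, h.2 ▸ ?_⟩
    rw [← Finset.sum_neg_distrib]
    exact Finset.sum_congr rfl fun m _ => by ring

/-! ### Vanishing and uniqueness of the continuations -/

/-- In a scaleless integral, the continuation of every primary sector vanishes. -/
theorem Scaleless.sectorIntegral_eq_zero {n : ℕ} {F : FeynmanIntegral L E (n + 1)}
    (hF : F.Scaleless) (N : MvPolynomial (LoopDot L E) ℂ) (j : Fin (n + 1)) (D : ℂ) :
    ∃ R : ℝ, ∀ ν : Fin (n + 1) → ℂ, (∀ i, i ≠ j → R < (ν i).re) →
      F.IsSectorIntegral N j ν D 0 ∧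
        ∀ g, F.IsSectorIntegral N j ν D g → g =ᶠ[Filter.codiscrete ℂ] 0 := by
  obtain ⟨R, hR⟩ := hF.exists_sector_continuation N j D
  refine ⟨R, fun ν hν => ?_⟩
  obtain ⟨G, hG, ⟨r, hUV⟩, ⟨r', hIR⟩⟩ := hR ν hν
  refine ⟨⟨G, -G, hG, hG.neg, ⟨r, hUV⟩, ⟨r', hIR⟩, (add_neg_cancel G).symm⟩, ?_⟩
  rintro g ⟨gUV, gIR, hgUV, hgIR, ⟨s, hs⟩, ⟨s', hs'⟩, rfl⟩
  have h1 : gUV =ᶠ[Filter.codiscrete ℂ] G := by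
    refine hgUV.eventuallyEq_codiscrete_of_eqOn hG (V := {ζ | max r s < ζ.re})
      (isOpen_lt continuous_const Complex.continuous_re) ⟨((max r s + 1 : ℝ) : ℂ),
        by rw [mem_ofPred_eq, Complex.ofReal_re]; exact lt_add_one _⟩ ?_
    intro ζ hζ
    rw [(hs ζ ((le_max_right _ _).trans_lt hζ)).2, (hUV ζ ((le_max_left _ _).trans_lt hζ)).2]
  have h2 : gIR =ᶠ[Filter.codiscrete ℂ] -G := by
    refine hgIR.eventuallyEq_codiscrete_of_eqOn hG.neg (V := {ζ | ζ.re < min r' s'})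
      (isOpen_lt Complex.continuous_re continuous_const) ⟨((min r' s' - 1 : ℝ) : ℂ),
        by rw [mem_ofPred_eq, Complex.ofReal_re]; exact sub_one_lt _⟩ ?_
    intro ζ hζ
    rw [(hs' ζ (hζ.trans_le (min_le_right _ _))).2, Pi.neg_apply,
      (hIR ζ (hζ.trans_le (min_le_left _ _))).2]
  simpa using h1.add h2

theorem Scaleless.isSectorContinuation_zero {n : ℕ} {F : FeynmanIntegral L E (n + 1)}
    (hF : F.Scaleless) (N : MvPolynomial (LoopDot L E) ℂ) (j : Fin (n + 1)) :
    F.IsSectorContinuation N j 0 1 := by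
  refine ⟨differentiable_const _, differentiable_const _, one_ne_zero, fun D => ?_⟩
  obtain ⟨R, hR⟩ := hF.sectorIntegral_eq_zero N j D
  exact ⟨R, fun ν hν => ⟨0, (hR ν hν).1, by simp⟩⟩

/-- The threshold on `Re ν_i` depends on `D`, so the identity theorem is applied in `ν` at each
fixed `D`. The relation `P = Q * g` with `g = 0` involves no division, so dimensions where `Q`
vanishes identically in `ν` cause no trouble. -/
theorem Scaleless.eq_zero_of_isSectorContinuation {n : ℕ} {F : FeynmanIntegral L E (n + 1)}
    (hF : F.Scaleless) {N : MvPolynomial (LoopDot L E) ℂ} {j : Fin (n + 1)}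
    {P Q : (Fin (n + 1) → ℂ) × ℂ → ℂ} (h : F.IsSectorContinuation N j P Q) : P = 0 := by
  obtain ⟨hP, -, -, hPQ⟩ := h
  have hPD : ∀ D, (fun ν => P (ν, D)) = 0 := by
    intro D
    obtain ⟨R, hR⟩ := hF.sectorIntegral_eq_zero N j D
    obtain ⟨R', hR'⟩ := hPQ D
    have hPd : Differentiable ℂ fun ν => P (ν, D) := by fun_prop
    refine hPd.eq_zero_of_eventually (w := fun _ => ((max R R' + 1 : ℝ) : ℂ)) ?_
    have hev : ∀ᶠ ν : Fin (n + 1) → ℂ in nhds fun _ => ((max R R' + 1 : ℝ) : ℂ),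
        ∀ i, max R R' < (ν i).re := by
      refine Filter.eventually_all.2 fun i => ?_
      exact (isOpen_lt continuous_const (Complex.continuous_re.comp (continuous_apply i))).mem_nhds
        (by rw [mem_ofPred_eq, Function.comp_apply, Complex.ofReal_re]; exact lt_add_one _)
    filter_upwards [hev] with ν hν
    obtain ⟨g, hg, hgP⟩ := hR' ν fun i _ => (le_max_right _ _).trans_lt (hν i)
    have hg0 := (hR ν fun i _ => (le_max_left _ _).trans_lt (hν i)).2 g hg
    have hcont : Continuous fun ζ => P (Function.update ν j ζ, D) :=
      hP.continuous.comp (((continuous_const (y := ν)).update j continuous_id).prodMk continuous_const)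
    -- `P` vanishes for codiscretely many `ζ`; continuity extends this to `ζ = ν j`, where the
    -- update is trivial.
    have := hcont.eq_zero_of_codiscrete (by
      filter_upwards [hgP, hg0] with ζ h1 h2
      rw [h1, h2, Pi.zero_apply, mul_zero]) (ν j)
    simpa using this
  funext z
  exact congrFun (hPD z.2) z.1

end FeynmanIntegral

theorem mainTheorem1 {L E p : ℕ} (hL : 1 ≤ L) (F : FeynmanIntegral L E p) (hF : F.Scaleless)
    (ε v : ℂ) :
    F.HasDimRegValue ((F.D₀ : ℂ) - 2 * ε) v ↔ v = 0 := by
  -- Without propagators the rank of `a` would be `0`, contradicting `1 ≤ L`.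
  obtain _ | n := p
  · have := F.rank_a
    have h0 := Matrix.rank_le_card_height (F.a.map (Int.cast : ℤ → ℝ))
    simp only [Fintype.card_fin] at h0
    omega
  constructor
  · rintro ⟨P, Q, ⟨hP, -, -, Ps, Qs, hs, hPQ⟩, -, rfl⟩
    -- The product of the denominators is a nonzero entire function, so it can be cancelled from `P
    -- * ∏ Qs = 0`.
    have hQ : ∀ s : Finset (Fin (n + 1)), Differentiable ℂ (fun z => ∏ j ∈ s, Qs j z) ∧
        (fun z => ∏ j ∈ s, Qs j z) ≠ 0 := by
      intro s
      induction s using Finset.induction_on with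
      | empty =>
        exact ⟨by simp, fun h => one_ne_zero (α := ℂ) (by simpa using congrFun h 0)⟩
      | insert i s hi ih =>
        simp_rw [Finset.prod_insert hi]
        exact ⟨(hs i).2.1.mul ih.1, fun h => (hs i).2.2.1
          ((hs i).2.1.eq_zero_of_mul_eq_zero ih.1 ih.2 fun z => congrFun h z)⟩
    have hP0 : P = 0 := by
      refine hP.eq_zero_of_mul_eq_zero (hQ Finset.univ).1 (hQ Finset.univ).2 fun z => ?_
      rw [hPQ z, Finset.sum_eq_zero fun j _ => ?_, mul_zero]
      rw [hF.eq_zero_of_isSectorContinuation (hs j), Pi.zero_apply, zero_mul]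
    simp [hP0]
  · rintro rfl
    refine ⟨0, 1, ⟨differentiable_const _, differentiable_const _, one_ne_zero, fun _ => 0,
      fun _ => 1, fun j => hF.isSectorContinuation_zero _ j, fun z => by simp⟩, by simp, by simp⟩
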